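/- **Theorem (Law of large numbers, case $\alpha=1$).** Let $\mathcal F$ be a probability distribution on $[0,1]$ with a density $f$ such that $f(x)\to c$ as $x\to1^-$, where $0<c<\infty$. Let $p_1,p_2,\dots$ be independent random variables with common distribution $\mathcal F$. For $n\ge 1$ consider the following batch learning model, given $p_1,\dots,p_n$. There are concepts $R_0,R_1,\dots,R_n$. A teacher produces a stream of independent, identically distributed random words; each word refers to $R_0$, and it refers to $R_i$ with probability $p_i$, independently for different $i\in\{1,\dots,n\}$. Let $L_j$ be the set of concepts to which the $j$-th word refers, let $k_0$ be the smallest $k\geq 0$ such that $L_1\cap\dots\cap L_k=\{R_0\}$ (the empty intersection being the set of all concepts), and let $T=T_n=T_n(p_1,\dots,p_n)$ be the expectation of $k_0$ for given $p_1,\dots,p_n$. Thus $T_n$ is a random variable through the $p_i$. Put $$T_{1,n}=\sum_{i=1}^n\Bigl(\frac1{1-p_i}-1\Bigr),\qquad T_{2,n}=\sum_{s\subseteq\{1,\dots,n\},\ |s|>1}(-1)^{|s|-1} \Bigl(\frac1{1-\prod_{i\in s}p_i}-1\Bigr).$$ Then there are a real constant $C$ and a real sequence $(b_n)$, depending only on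 $f$ and $c$, such that the following hold. 1. For every $n\ge1$, $T_n<\infty$ almost surely, but $\mathbf E(T_n)=\infty$; that is, $T_n$ has no expectation over the $p_i$. 2. Nevertheless $$\lim_{y\to\infty}\ \sup_{n\ge1}\ \mathbf P\bigl(|T_n/n-C|>y\bigr)=0 .$$ 3. (Cancellation of the $n\log n$ terms.) For every $n\ge1$, $T_n=1+T_{1,n}+T_{2,n}$ almost surely. Moreover $b_n/\log n\to c$ as $n\to\infty$, both $T_{1,n}/n-b_n$ and $T_{2,n}/n+b_n$ are bounded in probability, i.e. $$\lim_{y\to\infty}\sup_{n\ge1}\mathbf P\bigl(|T_{1,n}/n-b_n|>y\bigr)=0,\qquad \lim_{y\to\infty}\sup_{n\ge1}\mathbf P\bigl(|T_{2,n}/n+b_n|>y\bigr)=0,$$ and $T_{2,n}$ is integrable with $\mathbf E(T_{2,n})=-n\,b_n+O(n)$ for $n\ge1$. -/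

import Mathlib

open MeasureTheory ProbabilityTheory Filter Topology

namespace BatchLearning

/-- A word of the teacher, who teaches concept `0` among the concepts `0, 1, …, n`.  It always
refers to concept `0`; the entry `w i` tells whether it also refers to concept `i.succ`. -/
abbrev Word (n : ℕ) : Type := Fin n → Bool

/-- The list of all concepts to which a word refers. -/
def wordList {n : ℕ} (w : Word n) : Set (Fin (n + 1)) :=
  {j | j = 0 ∨ ∃ i : Fin n, j = i.succ ∧ w i = true}

/-- The concepts that are consistent with the first `k` words of the stream `w`. -/
def candidates {n : ℕ} (w : ℕ → Word n) (k : ℕ) : Set (Fin (n + 1)) :=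
  ⋂ j ∈ Set.Iio k, wordList (w j)

/-- The learning time: the smallest `k` such that only concept `0` is consistent with the first
`k` words (`⊤` if there is no such `k`). -/
noncomputable def learningTime {n : ℕ} (w : ℕ → Word n) : ℕ∞ :=
  ⨅ (k : ℕ) (_ : candidates w k = {0}), (k : ℕ∞)

/-- The law of a random word that refers to concept `i.succ` with probability `p i`, independently
for different `i`; so it refers to all concepts of a set `s` with probability `∏ i ∈ s, p i`. -/
noncomputable def wordLaw {n : ℕ} (p : Fin n → unitInterval) : Measure (Word n) :=
  Measure.pi fun i => bernoulliMeasure true false (p i)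

instance {n : ℕ} (p : Fin n → unitInterval) : IsProbabilityMeasure (wordLaw p) := by
  unfold wordLaw; infer_instance

/-- The law of the stream of independent, identically distributed words. -/
noncomputable def streamLaw {n : ℕ} (p : Fin n → unitInterval) : Measure (ℕ → Word n) :=
  Measure.infinitePi fun _ : ℕ => wordLaw p

/-- The expected learning time `T` of the batch learner, for given overlaps `p i`. -/
noncomputable def expectedTime {n : ℕ} (p : Fin n → unitInterval) : ENNReal :=
  ∫⁻ w, (learningTime w : ENNReal) ∂(streamLaw p)

/-- The singleton part of the inclusion–exclusion expansion of the expected learning time. -/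
noncomputable def singletonSum {n : ℕ} (p : Fin n → unitInterval) : ℝ :=
  ∑ i, (1 / (1 - (p i : ℝ)) - 1)

/-- The part of the inclusion–exclusion expansion that belongs to subsets with at least two
elements. -/
noncomputable def higherSum {n : ℕ} (p : Fin n → unitInterval) : ℝ :=
  ∑ s : Finset (Fin n) with 1 < s.card,
    (-1 : ℝ) ^ (s.card - 1) * (1 / (1 - ∏ i ∈ s, (p i : ℝ)) - 1)

/-- A sequence `X 1, X 2, …` of real random variables is bounded in probability:
`sup_{n ≥ 1} P (|X n| > y) → 0` as `y → ∞`. -/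
def BoundedInProbability {Ω : Type*} [MeasurableSpace Ω] (P : Measure Ω) (X : ℕ → Ω → ℝ) : Prop :=
  Tendsto (fun y : ℝ => ⨆ (n : ℕ) (_ : 1 ≤ n), P {ω | y < |X n ω|}) atTop (𝓝 0)

/-- The first `n` overlaps. -/
def overlaps {Ω : Type*} (p : ℕ → Ω → unitInterval) (n : ℕ) (ω : Ω) : Fin n → unitInterval :=
  fun i => p i ω

end BatchLearning

/-! ### The expected learning time as a series of tail probabilities -/

namespace BatchLearning

/-! Summing tails, `T = ∑ₖ (1 - ∏ᵢ (1 - pᵢᵏ))`. Expanding the products and summing geometric series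
gives `T = 1 + T₁ + T₂`, where the `1` is the term `k = 0`.

Write `mₖ` for the `k`-th moment of the law. Near 1 the density is close to `c`, so `(k+1) mₖ → c`.
Hence `∑ mₖ` diverges, which forces `E T = ∞`, and `bₙ = m₁ + ⋯ + mₙ` grows like `c log n`.

Everything is cut at the exponent `n`. In `T`, the terms with `k ≤ n` are probabilities and add up
to at most `n + 1`. The later ones are at most `∑ᵢ pᵢᵏ` and add up to at most `restSum`, which is
`O(n)` in probability: with high probability no `pᵢ` is within order `1/n` of 1, and `∑ᵢ pᵢⁿ⁺¹` has
bounded mean (`measure_restSum_le`). So no logarithm appears in `T`. In `T₁`, the exponents up to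
`n` form a sum of independent variables with mean `n bₙ` and variance `O(n²)`
(`integral_sq_geom_le`), so `T₁ / n - bₙ` is tight by Chebyshev. Then `T₂ = T - 1 - T₁` must be
centred at `-n bₙ`.

For `E T₂`, the series `-T₂ = ∑_{k ≥ 1} (∑ᵢ pᵢᵏ - tailProb k)` has nonnegative terms with means `n
mₖ - 1 + (1 - mₖ)ⁿ`. Those with `k ≤ n` give `n bₙ + O(n)`; the others are at most `(n mₖ)²` and
give `O(n)`. -/

/-- Every concept has been ruled out by one of the first `k` words. -/
def Learned {n : ℕ} (w : ℕ → Word n) (k : ℕ) : Prop :=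
  ∀ i : Fin n, ∃ j < k, w j i = false

lemma candidates_eq_singleton_iff {n : ℕ} (w : ℕ → Word n) (k : ℕ) :
    candidates w k = {0} ↔ Learned w k := by
  simp only [candidates, Set.ext_iff, Set.mem_iInter, Set.mem_Iio, Set.mem_singleton_iff,
    wordList, Set.mem_ofPred_eq, Learned]
  constructor
  · intro h i
    by_contra! hc
    refine (Fin.succ_ne_zero i) ((h i.succ).1 fun j hj => Or.inr ⟨i, rfl, ?_⟩)
    simpa using hc j hj
  · intro h x
    refine ⟨fun hx => ?_, fun hx j _ => Or.inl hx⟩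
    by_contra hx0
    obtain ⟨i, rfl⟩ := Fin.exists_succ_eq.2 hx0
    obtain ⟨j, hj, hji⟩ := h i
    rcases hx j hj with h0 | ⟨i', hi', ht⟩
    · exact hx0 h0
    · rw [← Fin.succ_injective _ hi'] at ht
      simp [hji] at ht

lemma Learned.mono {n : ℕ} {w : ℕ → Word n} {k l : ℕ} (hkl : k ≤ l) (h : Learned w k) :
    Learned w l := fun i =>
  let ⟨j, hj, hji⟩ := h i
  ⟨j, hj.trans_le hkl, hji⟩

open Classical in
-- A monotone predicate fails exactly below its first success, so the first success is the number of
-- failures. If it never holds, both sides are `⊤`.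
lemma toENNReal_iInf_eq_tsum {Q : ℕ → Prop} (hQ : ∀ k l, k ≤ l → Q k → Q l) :
    ((⨅ (k : ℕ) (_ : Q k), (k : ℕ∞) : ℕ∞) : ENNReal) = ∑' k, if Q k then 0 else 1 := by
  by_cases h : ∃ k, Q k
  · have h1 : (⨅ (k : ℕ) (_ : Q k), (k : ℕ∞) : ℕ∞) = (Nat.find h : ℕ∞) := by
      apply le_antisymm
      · exact iInf₂_le (Nat.find h) (Nat.find_spec h)
      · exact le_iInf₂ fun k hk => by exact_mod_cast Nat.find_min' h hk
    rw [h1, tsum_eq_sum (s := Finset.range (Nat.find h))]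
    · rw [Finset.sum_congr rfl fun k hk => if_neg (Nat.find_min h (Finset.mem_range.1 hk))]
      simp
    · intro k hk
      rw [if_pos]
      exact hQ _ _ (by simpa using hk) (Nat.find_spec h)
  · push Not at h
    simp [h]

open Classical in
lemma learningTime_eq_tsum {n : ℕ} (w : ℕ → Word n) :
    (learningTime w : ENNReal) = ∑' k, if Learned w k then 0 else 1 := by
  rw [← toENNReal_iInf_eq_tsum fun k l hkl h => h.mono hkl, learningTime]
  simp only [candidates_eq_singleton_iff]

lemma measurableSet_refers {n : ℕ} (i : Fin n) (k : ℕ) :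
    MeasurableSet {w : ℕ → Word n | ∀ j < k, w j i = true} := by
  have : {w : ℕ → Word n | ∀ j < k, w j i = true} =
      ⋂ j ∈ Set.Iio k, (fun w : ℕ → Word n => w j i) ⁻¹' {true} := by
    ext w; simp
  rw [this]
  exact MeasurableSet.biInter (Set.to_countable _) fun j _ =>
    (by fun_prop : Measurable fun w : ℕ → Word n => w j i) (measurableSet_singleton _)

lemma setOf_learned {n : ℕ} (k : ℕ) :
    {w : ℕ → Word n | Learned w k} = ⋂ i, {w : ℕ → Word n | ∀ j < k, w j i = true}ᶜ := by
  ext w; simp [Learned]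

lemma measurableSet_learned {n : ℕ} (k : ℕ) : MeasurableSet {w : ℕ → Word n | Learned w k} := by
  rw [setOf_learned]
  exact MeasurableSet.iInter fun i => (measurableSet_refers i k).compl

lemma wordLaw_refers {n : ℕ} (p : Fin n → unitInterval) (s : Finset (Fin n)) :
    (wordLaw p).real {w | ∀ i ∈ s, w i = true} = ∏ i ∈ s, (p i : ℝ) := by
  classical
  have h : {w : Word n | ∀ i ∈ s, w i = true} =
      Set.pi Set.univ fun i => if i ∈ s then {true} else Set.univ := by
    ext w
    simp only [Set.mem_ofPred_eq, Set.mem_pi, Set.mem_univ, true_imp_iff]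
    refine forall_congr' fun i => ?_
    by_cases hi : i ∈ s <;> simp [hi]
  rw [measureReal_def, h, wordLaw, Measure.pi_pi, ENNReal.toReal_prod]
  rw [← Finset.prod_subset (Finset.subset_univ s)]
  · refine Finset.prod_congr rfl fun i hi => ?_
    rw [if_pos hi, ← measureReal_def,
      bernoulliMeasure_real_apply_of_mem_of_notMem _ (measurableSet_singleton _) (by simp)
        (by simp)]
  · intro i _ hi
    simp [hi]

lemma streamLaw_refers {n : ℕ} (p : Fin n → unitInterval) (s : Finset (Fin n)) (k : ℕ) :
    (streamLaw p).real (⋂ i ∈ s, {w | ∀ j < k, w j i = true}) = ∏ i ∈ s, (p i : ℝ) ^ k := by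
  have h : (⋂ i ∈ s, {w : ℕ → Word n | ∀ j < k, w j i = true}) =
      Set.pi (Finset.range k) fun _ => {w : Word n | ∀ i ∈ s, w i = true} := by
    ext w; simp only [Set.mem_iInter, Set.mem_ofPred_eq, Set.mem_pi, Finset.coe_range, Set.mem_Iio]
    exact ⟨fun h j hj i hi => h i hi j hj, fun h i hi j hj => h j hj i hi⟩
  rw [measureReal_def, h, streamLaw, Measure.infinitePi_pi, ENNReal.toReal_prod]
  · simp only [← measureReal_def, wordLaw_refers, Finset.prod_const, Finset.card_range,
      Finset.prod_pow]
  · exact fun _ _ => (Set.toFinite _).measurableSet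

instance {n : ℕ} (p : Fin n → unitInterval) : IsProbabilityMeasure (streamLaw p) := by
  unfold streamLaw; infer_instance

lemma prod_one_sub_eq_sum_powerset {ι R : Type*} [CommRing R] (s : Finset ι) (x : ι → R) :
    ∏ i ∈ s, (1 - x i) = ∑ t ∈ s.powerset, (-1) ^ t.card * ∏ i ∈ t, x i := by
  classical
  simp [Finset.prod_sub]

/-- Inclusion–exclusion for the probability of the intersection of complements. -/
lemma measureReal_iInter_compl {Ω ι : Type*} [MeasurableSpace Ω] [Fintype ι] (μ : Measure Ω)
    [IsFiniteMeasure μ] {A : ι → Set Ω} (hA : ∀ i, MeasurableSet (A i)) :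
    μ.real (⋂ i, (A i)ᶜ) = ∑ s : Finset ι, (-1) ^ s.card * μ.real (⋂ i ∈ s, A i) := by
  classical
  have h1 : ∀ s : Finset ι, ∀ ω,
      (⋂ i ∈ s, A i).indicator (1 : Ω → ℝ) ω = ∏ i ∈ s, (A i).indicator 1 ω := by
    intro s ω
    by_cases h : ∀ i ∈ s, ω ∈ A i
    · rw [Set.indicator_of_mem (by simpa using h), Finset.prod_eq_one]
      · rfl
      · intro i hi; rw [Set.indicator_of_mem (h i hi)]; rfl
    · rw [Set.indicator_of_notMem (by simpa using h)]
      push Not at h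
      obtain ⟨i, hi, hiA⟩ := h
      rw [Finset.prod_eq_zero hi (Set.indicator_of_notMem hiA _)]
  -- Expanding the product of the indicators `1 - 1_{A i}` gives the formula pointwise; integration
  -- finishes the proof.
  have h2 : ∀ ω, (⋂ i, (A i)ᶜ).indicator (1 : Ω → ℝ) ω =
      ∑ s : Finset ι, (-1) ^ s.card * (⋂ i ∈ s, A i).indicator (1 : Ω → ℝ) ω := by
    intro ω
    simp only [h1]
    rw [← Finset.powerset_univ, ← prod_one_sub_eq_sum_powerset]
    by_cases h : ∀ i, ω ∉ A i
    · rw [Set.indicator_of_mem (by simpa using h), Finset.prod_eq_one]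
      · rfl
      · intro i _; rw [Set.indicator_of_notMem (h i), sub_zero]
    · rw [Set.indicator_of_notMem (by simpa using h)]
      push Not at h
      obtain ⟨i, hi⟩ := h
      rw [Finset.prod_eq_zero (Finset.mem_univ i)]
      rw [Set.indicator_of_mem hi]; simp
  have hms : ∀ s : Finset ι, MeasurableSet (⋂ i ∈ s, A i) := fun s =>
    Finset.measurableSet_biInter _ fun i _ => hA i
  rw [← integral_indicator_one (MeasurableSet.iInter fun i => (hA i).compl),
    integral_congr_ae (Eventually.of_forall h2), integral_finsetSum]
  · refine Finset.sum_congr rfl fun s _ => ?_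
    rw [integral_const_mul, integral_indicator_one (hms s)]
  · exact fun s _ => ((integrable_const (1 : ℝ)).indicator (hms s)).const_mul _

/-- Joint references have product probabilities, so the inclusion–exclusion sum is the expansion of
this product and collapses back to it. -/
lemma streamLaw_learned {n : ℕ} (p : Fin n → unitInterval) (k : ℕ) :
    (streamLaw p).real {w | Learned w k} = ∏ i, (1 - (p i : ℝ) ^ k) := by
  rw [setOf_learned, measureReal_iInter_compl _ fun i => measurableSet_refers i k,
    prod_one_sub_eq_sum_powerset, Finset.powerset_univ]
  simp only [streamLaw_refers]

/-- The probability that `k` words do not suffice. -/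
noncomputable def tailProb {n : ℕ} (p : Fin n → unitInterval) (k : ℕ) : ℝ :=
  1 - ∏ i, (1 - (p i : ℝ) ^ k)

lemma expectedTime_eq_tsum {n : ℕ} (p : Fin n → unitInterval) :
    expectedTime p = ∑' k, ENNReal.ofReal (tailProb p k) := by
  classical
  simp only [expectedTime, learningTime_eq_tsum]
  rw [lintegral_tsum]
  · refine tsum_congr fun k => ?_
    have h : ∀ w : ℕ → Word n, (if Learned w k then (0 : ENNReal) else 1) =
        ({w | Learned w k}ᶜ).indicator 1 w := by
      intro w
      by_cases hw : Learned w k <;> simp [hw]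
    simp only [h]
    rw [lintegral_indicator_one (measurableSet_learned k).compl, tailProb, ← streamLaw_learned,
      ← probReal_compl_eq_one_sub (measurableSet_learned k), ofReal_measureReal]
  · intro k
    exact (Measurable.ite (measurableSet_learned k) measurable_const measurable_const).aemeasurable

end BatchLearning

/-! ### Inclusion–exclusion for fixed overlaps, and the cut of the series -/

namespace BatchLearning

lemma hasSum_pow_add {x : ℝ} (h0 : 0 ≤ x) (h1 : x < 1) (m : ℕ) :
    HasSum (fun k => x ^ (k + m)) (x ^ m / (1 - x)) := by
  simp only [pow_add, div_eq_inv_mul]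
  exact (hasSum_geometric_of_lt_one h0 h1).mul_right _

lemma hasSum_pow_succ {x : ℝ} (h0 : 0 ≤ x) (h1 : x < 1) :
    HasSum (fun k => x ^ (k + 1)) (1 / (1 - x) - 1) := by
  have h := hasSum_pow_add h0 h1 1
  have : 1 - x ≠ 0 := by linarith
  convert h using 1
  field_simp
  ring

lemma one_sub_sum_le_prod {ι : Type*} (s : Finset ι) {x : ι → ℝ} (h0 : ∀ i, 0 ≤ x i)
    (h1 : ∀ i, x i ≤ 1) : 1 - ∑ i ∈ s, x i ≤ ∏ i ∈ s, (1 - x i) := by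
  classical
  induction s using Finset.induction_on with
  | empty => simp
  | insert a s ha ih =>
    rw [Finset.sum_insert ha, Finset.prod_insert ha]
    have h2 : ∏ i ∈ s, (1 - x i) ≤ 1 :=
      Finset.prod_le_one (fun i _ => by linarith [h1 i]) fun i _ => by linarith [h0 i]
    nlinarith [h0 a, h1 a]

variable {n : ℕ} (p : Fin n → unitInterval)

lemma pow_mem_unitInterval (i : Fin n) (k : ℕ) : 0 ≤ (p i : ℝ) ^ k ∧ (p i : ℝ) ^ k ≤ 1 :=
  ⟨pow_nonneg (p i).2.1 k, pow_le_one₀ (p i).2.1 (p i).2.2⟩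

lemma tailProb_nonneg (k : ℕ) : 0 ≤ tailProb p k := by
  have : ∏ i, (1 - (p i : ℝ) ^ k) ≤ 1 :=
    Finset.prod_le_one (fun i _ => by linarith [(pow_mem_unitInterval p i k).2])
      fun i _ => by linarith [(pow_mem_unitInterval p i k).1]
  rw [tailProb]; linarith

lemma tailProb_le_one (k : ℕ) : tailProb p k ≤ 1 := by
  have : 0 ≤ ∏ i, (1 - (p i : ℝ) ^ k) :=
    Finset.prod_nonneg fun i _ => by linarith [(pow_mem_unitInterval p i k).2]
  rw [tailProb]; linarith

lemma tailProb_le_sum (k : ℕ) : tailProb p k ≤ ∑ i, (p i : ℝ) ^ k := by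
  have := one_sub_sum_le_prod Finset.univ (fun i => (pow_mem_unitInterval p i k).1)
    fun i => (pow_mem_unitInterval p i k).2
  rw [tailProb]; linarith

/-- Since `x ^ 0 = 1`, one factor suffices to kill the product. This is the constant `1` in `T = 1 +
T₁ + T₂`; for `n = 0` the product is empty and the value is `0`. -/
lemma tailProb_zero (hn : 1 ≤ n) : tailProb p 0 = 1 := by
  rw [tailProb, Finset.prod_eq_zero (Finset.mem_univ (⟨0, hn⟩ : Fin n)) (by simp), sub_zero]

lemma sum_finset_eq (g : Finset (Fin n) → ℝ) :
    ∑ s, g s = g ∅ + ∑ i, g {i} + ∑ s : Finset (Fin n) with 1 < s.card, g s := by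
  classical
  have h1 : ∑ i, g {i} = ∑ s : Finset (Fin n) with s.card = 1, g s := by
    refine Finset.sum_bij (fun i _ => {i}) (by simp) (by simp) ?_ (by simp)
    intro s hs
    obtain ⟨a, rfl⟩ := Finset.card_eq_one.1 (Finset.mem_filter.1 hs).2
    exact ⟨a, Finset.mem_univ _, rfl⟩
  rw [h1, ← Finset.sum_filter_add_sum_filter_not Finset.univ
    (fun s : Finset (Fin n) => 1 < s.card) g, add_comm]
  congr 1
  rw [← Finset.sum_filter_add_sum_filter_not
    (Finset.univ.filter fun s : Finset (Fin n) => ¬ 1 < s.card) (fun s => s.card = 1) g, add_comm]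
  congr 1
  · have : (Finset.univ.filter fun s : Finset (Fin n) => ¬ 1 < s.card).filter
        (fun s => ¬ s.card = 1) = {∅} := by
      ext s
      simp only [Finset.mem_filter, Finset.mem_univ, true_and, Finset.mem_singleton,
        ← Finset.card_eq_zero]
      omega
    rw [this, Finset.sum_singleton]
  · rw [Finset.filter_filter]
    refine Finset.sum_congr (Finset.filter_congr fun s _ => by omega) fun _ _ => rfl

lemma tailProb_expansion (k : ℕ) :
    tailProb p k = ∑ i, (p i : ℝ) ^ k + ∑ s : Finset (Fin n) with 1 < s.card,
      (-1 : ℝ) ^ (s.card - 1) * (∏ i ∈ s, (p i : ℝ)) ^ k := by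
  rw [tailProb, prod_one_sub_eq_sum_powerset, Finset.powerset_univ, sum_finset_eq]
  have : ∑ s : Finset (Fin n) with 1 < s.card, (-1 : ℝ) ^ s.card * ∏ i ∈ s, (p i : ℝ) ^ k =
      -∑ s : Finset (Fin n) with 1 < s.card,
        (-1 : ℝ) ^ (s.card - 1) * (∏ i ∈ s, (p i : ℝ)) ^ k := by
    rw [← Finset.sum_neg_distrib]
    refine Finset.sum_congr rfl fun s hs => ?_
    obtain ⟨m, hm⟩ : ∃ m, s.card = m + 1 := ⟨s.card - 1, by
      have := (Finset.mem_filter.1 hs).2; omega⟩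
    rw [hm, Finset.prod_pow, Nat.add_sub_cancel, pow_succ]
    ring
  rw [this]
  simp only [Finset.card_empty, pow_zero, Finset.prod_empty, mul_one, Finset.card_singleton, pow_one,
    Finset.prod_singleton, neg_mul, one_mul, Finset.sum_neg_distrib]
  ring

variable {p}

lemma prod_lt_one (hp : ∀ i, (p i : ℝ) < 1) {s : Finset (Fin n)} (hs : s.Nonempty) :
    ∏ i ∈ s, (p i : ℝ) < 1 := by
  classical
  obtain ⟨i, hi⟩ := hs
  rw [← Finset.mul_prod_erase s _ hi]
  refine lt_of_le_of_lt (mul_le_of_le_one_right (p i).2.1 ?_) (hp i)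
  exact Finset.prod_le_one (fun j _ => (p j).2.1) fun j _ => (p j).2.2

lemma hasSum_singletonSum (hp : ∀ i, (p i : ℝ) < 1) :
    HasSum (fun k => ∑ i, (p i : ℝ) ^ (k + 1)) (singletonSum p) :=
  hasSum_sum fun i _ => hasSum_pow_succ (p i).2.1 (hp i)

/-- The series starts at exponent 1 because `1 / (1 - x) - 1` is the geometric series without its
constant term. The exponent 0 is accounted for by `tailProb p 0`. -/
lemma hasSum_higherSum (hp : ∀ i, (p i : ℝ) < 1) :
    HasSum (fun k => tailProb p (k + 1) - ∑ i, (p i : ℝ) ^ (k + 1)) (higherSum p) := by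
  simp only [tailProb_expansion, add_sub_cancel_left]
  refine hasSum_sum fun s hs => HasSum.mul_left _ (hasSum_pow_succ ?_ ?_)
  · exact Finset.prod_nonneg fun i _ => (p i).2.1
  · exact prod_lt_one hp (Finset.card_pos.1 (by have := (Finset.mem_filter.1 hs).2; omega))

lemma hasSum_tailProb (hp : ∀ i, (p i : ℝ) < 1) :
    HasSum (tailProb p) (tailProb p 0 + singletonSum p + higherSum p) := by
  have h := (hasSum_singletonSum hp).add (hasSum_higherSum hp)
  simp only [add_sub_cancel] at h
  rw [hasSum_nat_add_iff 1] at h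
  simpa [add_comm, add_left_comm, add_assoc] using h

lemma expectedTime_eq_ofReal (hp : ∀ i, (p i : ℝ) < 1) :
    expectedTime p = ENNReal.ofReal (tailProb p 0 + singletonSum p + higherSum p) := by
  rw [expectedTime_eq_tsum, ← (hasSum_tailProb hp).tsum_eq,
    ENNReal.ofReal_tsum_of_nonneg (tailProb_nonneg p) (hasSum_tailProb hp).summable]

lemma toReal_expectedTime (hp : ∀ i, (p i : ℝ) < 1) :
    (expectedTime p).toReal = tailProb p 0 + singletonSum p + higherSum p := by
  rw [expectedTime_eq_ofReal hp, ENNReal.toReal_ofReal]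
  exact (hasSum_tailProb hp).nonneg (tailProb_nonneg p)

lemma expectedTime_lt_top (hp : ∀ i, (p i : ℝ) < 1) : expectedTime p < ⊤ := by
  rw [expectedTime_eq_ofReal hp]; exact ENNReal.ofReal_lt_top

/-- The contribution to the singleton part of the exponents up to `m`. -/
noncomputable def headSum (p : Fin n → unitInterval) (m : ℕ) : ℝ :=
  ∑ i, ∑ k ∈ Finset.range m, (p i : ℝ) ^ (k + 1)

/-- The contribution to the singleton part of the exponents beyond `m`. -/
noncomputable def restSum (p : Fin n → unitInterval) (m : ℕ) : ℝ :=
  ∑ i, (p i : ℝ) ^ (m + 1) / (1 - (p i : ℝ))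

lemma restSum_nonneg (p : Fin n → unitInterval) (m : ℕ) : 0 ≤ restSum p m :=
  Finset.sum_nonneg fun i _ =>
    div_nonneg (pow_mem_unitInterval p i _).1 (by linarith [(p i).2.2])

lemma singletonSum_eq (hp : ∀ i, (p i : ℝ) < 1) (m : ℕ) :
    singletonSum p = headSum p m + restSum p m := by
  rw [headSum, restSum, ← Finset.sum_add_distrib, singletonSum]
  refine Finset.sum_congr rfl fun i _ => ?_
  refine (hasSum_pow_succ (p i).2.1 (hp i)).unique ?_
  have h := hasSum_pow_add (p i).2.1 (hp i) (m + 1)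
  have h' : HasSum (fun k => (p i : ℝ) ^ (k + m + 1)) ((p i : ℝ) ^ (m + 1) / (1 - (p i : ℝ))) := h
  rw [hasSum_nat_add_iff (f := fun k => (p i : ℝ) ^ (k + 1)) m] at h'
  rwa [add_comm]

/-- Probabilities are bounded by 1 up to the exponent `m` and by the union bound beyond it. With `m
= n` this avoids the logarithm that the union bound alone would produce. -/
lemma toReal_expectedTime_le (hp : ∀ i, (p i : ℝ) < 1) (m : ℕ) :
    (expectedTime p).toReal ≤ m + 1 + restSum p m := by
  rw [toReal_expectedTime hp, ← (hasSum_tailProb hp).tsum_eq,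
    ← (hasSum_tailProb hp).summable.sum_add_tsum_nat_add (m + 1)]
  refine add_le_add ?_ ?_
  · refine (Finset.sum_le_sum fun k _ => tailProb_le_one p k).trans ?_
    simp
  · have h : HasSum (fun k => ∑ i, (p i : ℝ) ^ (k + (m + 1))) (restSum p m) :=
      hasSum_sum fun i _ => hasSum_pow_add (p i).2.1 (hp i) (m + 1)
    rw [← h.tsum_eq]
    exact Summable.tsum_le_tsum (fun k => tailProb_le_sum p _)
      ((summable_nat_add_iff (m + 1)).2 (hasSum_tailProb hp).summable) h.summable

/-- The expected time dominates the geometric series of each overlap. -/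
lemma tsum_pow_le_expectedTime (p : Fin n → unitInterval) (i : Fin n) :
    ∑' k, ENNReal.ofReal ((p i : ℝ) ^ k) ≤ expectedTime p := by
  classical
  rw [expectedTime_eq_tsum]
  refine ENNReal.tsum_le_tsum fun k => ENNReal.ofReal_le_ofReal ?_
  rw [tailProb, ← Finset.mul_prod_erase _ _ (Finset.mem_univ i)]
  have h1 := pow_mem_unitInterval p i k
  have h2 : ∏ j ∈ Finset.univ.erase i, (1 - (p j : ℝ) ^ k) ≤ 1 :=
    Finset.prod_le_one (fun j _ => by linarith [(pow_mem_unitInterval p j k).2])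
      fun j _ => by linarith [(pow_mem_unitInterval p j k).1]
  nlinarith

end BatchLearning

/-! ### Moments of the law and its mass near 1 -/

namespace BatchLearning

/-- The law on the unit interval with density `f`. -/
noncomputable def densityLaw (f : ℝ → ℝ) : Measure ℝ :=
  (volume.restrict (Set.Icc (0 : ℝ) 1)).withDensity fun x => ENNReal.ofReal (f x)

/-- The moments of the law with density `f`. -/
noncomputable def moment (f : ℝ → ℝ) (k : ℕ) : ℝ := ∫ x, x ^ k ∂densityLaw f

variable {f : ℝ → ℝ} {c : ℝ}

lemma integrableOn_density (hf : Measurable f) (hF : IsProbabilityMeasure (densityLaw f))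
    (h0 : ∀ x ∈ Set.Icc (0 : ℝ) 1, 0 ≤ f x) : IntegrableOn f (Set.Icc 0 1) := by
  refine ⟨hf.aestronglyMeasurable, ?_⟩
  rw [hasFiniteIntegral_iff_ofReal]
  · have h := hF.measure_univ
    rw [densityLaw, withDensity_apply _ MeasurableSet.univ, Measure.restrict_univ] at h
    rw [h]; exact ENNReal.one_lt_top
  · exact (ae_restrict_iff' measurableSet_Icc).2 (Eventually.of_forall h0)

lemma moment_eq (hf : Measurable f) (h0 : ∀ x ∈ Set.Icc (0 : ℝ) 1, 0 ≤ f x) (k : ℕ) :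
    moment f k = ∫ x in Set.Ico (0 : ℝ) 1, x ^ k * f x := by
  rw [integral_Ico_eq_integral_Ioo, ← integral_Icc_eq_integral_Ioo, moment, densityLaw,
    integral_withDensity_eq_integral_toReal_smul (by fun_prop)
      (Eventually.of_forall fun _ => ENNReal.ofReal_lt_top)]
  refine setIntegral_congr_fun measurableSet_Icc fun x hx => ?_
  simp only [ENNReal.toReal_ofReal (h0 x hx), smul_eq_mul, mul_comm]

lemma tendsto_succ_mul_pow {r : ℝ} (h0 : 0 ≤ r) (h1 : r < 1) :
    Tendsto (fun k : ℕ => ((k : ℝ) + 1) * r ^ k) atTop (𝓝 0) := by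
  have h := (tendsto_self_mul_const_pow_of_lt_one h0 h1).add
    (tendsto_pow_atTop_nhds_zero_of_lt_one h0 h1)
  simpa [add_mul] using h

/-- The kernels `(k + 1) x ^ k` on `[0, 1)` have mass 1 and concentrate at 1, so integrating `f`
against them picks out its left limit there. -/
lemma tendsto_succ_mul_moment (hf : Measurable f) (hF : IsProbabilityMeasure (densityLaw f))
    (h0 : ∀ x ∈ Set.Icc (0 : ℝ) 1, 0 ≤ f x) (hlim : Tendsto f (𝓝[<] 1) (𝓝 c)) :
    Tendsto (fun k : ℕ => ((k : ℝ) + 1) * moment f k) atTop (𝓝 c) := by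
  have key := tendsto_setIntegral_peak_smul_of_integrableOn_of_tendsto (μ := volume)
    (s := Set.Ico (0 : ℝ) 1) (t := Set.Ico (0 : ℝ) 1) (x₀ := 1) (l := atTop) (g := f) (a := c)
    (φ := fun (k : ℕ) x => ((k : ℝ) + 1) * x ^ k)
    measurableSet_Ico measurableSet_Ico subset_rfl self_mem_nhdsWithin (by simp)
    (Eventually.of_forall fun k x hx => by have := hx.1; positivity) ?_ ?_
    (Eventually.of_forall fun k => by fun_prop)
    ((integrableOn_density hf hF h0).mono_set Set.Ico_subset_Icc_self)
    (hlim.mono_left (nhdsWithin_mono _ fun x hx => hx.2))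
  · refine key.congr fun k => ?_
    rw [moment_eq hf h0, ← integral_const_mul]
    simp only [smul_eq_mul, mul_assoc]
  · intro u hu h1u
    obtain ⟨δ, hδ, hδu⟩ := Metric.isOpen_iff.1 hu 1 h1u
    -- Off the `δ`-ball around 1 the kernel is at most `(k + 1) r ^ k`; the maximum with 0 covers `δ
    -- > 1`.
    set r : ℝ := max 0 (1 - δ) with hr
    have hr0 : 0 ≤ r := le_max_left _ _
    have hr1 : r < 1 := max_lt one_pos (by linarith)
    rw [Metric.tendstoUniformlyOn_iff]
    intro ε hε
    filter_upwards [(tendsto_order.1 (tendsto_succ_mul_pow hr0 hr1)).2 ε hε] with k hk x hx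
    have hxr : x ≤ r := by
      by_contra! hc
      refine hx.2 (hδu ?_)
      rw [Metric.mem_ball, Real.dist_eq, abs_lt]
      have := le_max_right 0 (1 - δ)
      constructor <;> linarith [hx.1.2]
    have hx0 := hx.1.1
    rw [Pi.zero_apply, dist_zero_left, Real.norm_of_nonneg (by positivity)]
    refine lt_of_le_of_lt ?_ hk
    gcongr
  · refine tendsto_const_nhds.congr fun k => ?_
    rw [integral_Ico_eq_integral_Ioo, ← integral_Ioc_eq_integral_Ioo,
      ← intervalIntegral.integral_of_le zero_le_one, intervalIntegral.integral_const_mul,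
      integral_pow]
    have : (k : ℝ) + 1 ≠ 0 := by positivity
    simp [this]

lemma exists_moment_le (hf : Measurable f) (hF : IsProbabilityMeasure (densityLaw f))
    (h0 : ∀ x ∈ Set.Icc (0 : ℝ) 1, 0 ≤ f x) (hlim : Tendsto f (𝓝[<] 1) (𝓝 c)) :
    ∃ D : ℝ, 0 ≤ D ∧ ∀ k : ℕ, moment f k ≤ D / (k + 1) := by
  obtain ⟨D, hD⟩ := (tendsto_succ_mul_moment hf hF h0 hlim).bddAbove_range
  refine ⟨max D 0, le_max_right _ _, fun k => ?_⟩
  rw [le_div_iff₀ (by positivity), mul_comm]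
  exact (hD ⟨k, rfl⟩).trans (le_max_left _ _)

/-- On some `(a, 1)` the density is below `c + 1`, which settles `ε ≤ 1 - a`. For larger `ε` the
bound exceeds 1 because `K ≥ 1 / (1 - a)`. -/
lemma exists_tail_le (hF : IsProbabilityMeasure (densityLaw f))
    (hlim : Tendsto f (𝓝[<] 1) (𝓝 c)) :
    ∃ K : ℝ, 0 ≤ K ∧ ∀ ε : ℝ, 0 < ε →
      densityLaw f (Set.Ioi (1 - ε)) ≤ ENNReal.ofReal (K * ε) := by
  obtain ⟨a, ha1, ha⟩ := (mem_nhdsLT_iff_exists_Ioo_subset).1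
    ((tendsto_order.1 hlim).2 (c + 1) (by linarith))
  have ha1 : 0 < 1 - a := sub_pos.2 ha1
  refine ⟨max (c + 1) (1 / (1 - a)), (by positivity : 0 ≤ 1 / (1 - a)).trans (le_max_right _ _),
    fun ε hε => ?_⟩
  by_cases hεa : ε ≤ 1 - a
  · have hsub : Set.Ioi (1 - ε) ∩ Set.Icc (0 : ℝ) 1 ⊆ Set.Ioc (1 - ε) 1 := fun x hx =>
      ⟨hx.1, hx.2.2⟩
    rw [densityLaw, withDensity_apply _ measurableSet_Ioi, Measure.restrict_restrict
      measurableSet_Ioi]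
    calc ∫⁻ x in Set.Ioi (1 - ε) ∩ Set.Icc (0 : ℝ) 1, ENNReal.ofReal (f x)
        ≤ ∫⁻ x in Set.Ioc (1 - ε) 1, ENNReal.ofReal (f x) :=
          lintegral_mono_set hsub
      _ = ∫⁻ x in Set.Ioo (1 - ε) 1, ENNReal.ofReal (f x) := by
          rw [restrict_Ioo_eq_restrict_Ioc]
      _ ≤ ∫⁻ _ in Set.Ioo (1 - ε) 1, ENNReal.ofReal (c + 1) :=
          setLIntegral_mono measurable_const fun x hx => ENNReal.ofReal_le_ofReal
            (le_of_lt (ha ⟨by linarith [hx.1], hx.2⟩))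
      _ = ENNReal.ofReal (c + 1) * ENNReal.ofReal ε := by
          rw [setLIntegral_const, Real.volume_Ioo, sub_sub_cancel]
      _ ≤ _ := by
          rw [← ENNReal.ofReal_mul' hε.le]
          exact ENNReal.ofReal_le_ofReal (mul_le_mul_of_nonneg_right (le_max_left _ _) hε.le)
  · refine prob_le_one.trans ?_
    rw [ENNReal.one_le_ofReal]
    push Not at hεa
    calc (1 : ℝ) ≤ 1 / (1 - a) * ε := by
          rw [one_div_mul_eq_div, one_le_div ha1]; exact hεa.le
      _ ≤ _ := mul_le_mul_of_nonneg_right (le_max_right _ _) hε.le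

/-- The normalizing sequence: the truncated geometric series of the moments. -/
noncomputable def centering (f : ℝ → ℝ) (n : ℕ) : ℝ := ∑ k ∈ Finset.range n, moment f (k + 1)

lemma harmonic_eq_sum (n : ℕ) :
    ((harmonic n : ℚ) : ℝ) = ∑ k ∈ Finset.range n, (1 : ℝ) / (k + 1) := by
  simp [harmonic]

lemma tendsto_log_natCast : Tendsto (fun n : ℕ => Real.log n) atTop atTop :=
  Real.tendsto_log_atTop.comp tendsto_natCast_atTop_atTop

lemma tendsto_harmonic_div_log :
    Tendsto (fun n : ℕ => (∑ k ∈ Finset.range n, (1 : ℝ) / (k + 1)) / Real.log n) atTop (𝓝 1) := by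
  have h := (Real.tendsto_harmonic_sub_log.div_atTop tendsto_log_natCast).add_const 1
  rw [zero_add] at h
  refine h.congr' ?_
  filter_upwards [tendsto_log_natCast.eventually_ne_atTop 0] with n hn
  rw [harmonic_eq_sum, sub_div, div_self hn, sub_add_cancel]

/-- The difference `a k - c / (k + 1)` is `o(1 / (k + 1))`. As the harmonic series diverges, this
passes to partial sums, and harmonic numbers are asymptotic to `log n`. -/
lemma tendsto_sum_div_log {a : ℕ → ℝ} (ha : Tendsto (fun k : ℕ => ((k : ℝ) + 1) * a k) atTop (𝓝 c)) :
    Tendsto (fun n : ℕ => (∑ k ∈ Finset.range n, a k) / Real.log n) atTop (𝓝 c) := by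
  have hlit : (fun k : ℕ => a k - c * (1 / ((k : ℝ) + 1))) =o[atTop]
      fun k : ℕ => (1 : ℝ) / (k + 1) := by
    rw [Asymptotics.isLittleO_iff_tendsto' (Eventually.of_forall fun k hk => by
      have : (1 : ℝ) / (k + 1) ≠ 0 := by positivity
      exact absurd hk this)]
    have h := ha.sub_const c
    rw [sub_self] at h
    refine h.congr fun k => ?_
    have : (k : ℝ) + 1 ≠ 0 := by positivity
    field_simp
  have hs := hlit.sum_range (fun k => by positivity) (by
    have h := tendsto_harmonic_div_log.pos_mul_atTop one_pos tendsto_log_natCast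
    refine h.congr' ?_
    filter_upwards [tendsto_log_natCast.eventually_ne_atTop 0] with n hn
    rw [div_mul_cancel₀ _ hn])
  have h1 := (hs.tendsto_div_nhds_zero.mul tendsto_harmonic_div_log).add
    (tendsto_harmonic_div_log.const_mul c)
  rw [zero_mul, zero_add, mul_one] at h1
  refine h1.congr' ?_
  filter_upwards [eventually_ge_atTop 1] with n hn
  have hpos : 0 < ∑ k ∈ Finset.range n, (1 : ℝ) / (k + 1) :=
    Finset.sum_pos (fun k _ => by positivity) (by simpa using (by omega : n ≠ 0))
  rw [div_mul_div_cancel₀ hpos.ne', Finset.sum_sub_distrib, ← Finset.mul_sum, ← mul_div_assoc,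
    ← add_div, sub_add_cancel]

lemma tendsto_centering_div_log (hf : Measurable f) (hF : IsProbabilityMeasure (densityLaw f))
    (h0 : ∀ x ∈ Set.Icc (0 : ℝ) 1, 0 ≤ f x) (hlim : Tendsto f (𝓝[<] 1) (𝓝 c)) :
    Tendsto (fun n : ℕ => centering f n / Real.log n) atTop (𝓝 c) := by
  refine tendsto_sum_div_log ?_
  -- The centering starts at the first moment, so the weight is `k + 1` where the moment asymptotics
  -- has `k + 2`; the factor `(k + 1) / (k + 2)` corrects this.
  have h := (tendsto_add_atTop_iff_nat 1).2 (tendsto_succ_mul_moment hf hF h0 hlim)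
  have hr := (tendsto_natCast_div_add_atTop (1 : ℝ)).comp (tendsto_add_atTop_nat 1)
  have := h.mul hr
  rw [mul_one] at this
  refine this.congr fun k => ?_
  simp only [Function.comp_apply]
  push_cast
  have : (k : ℝ) + 1 + 1 ≠ 0 := by positivity
  field_simp

lemma moment_nonneg (k : ℕ) : 0 ≤ moment f k := by
  refine integral_nonneg_of_ae ?_
  have : ∀ᵐ x ∂densityLaw f, x ∈ Set.Icc (0 : ℝ) 1 :=
    (withDensity_absolutelyContinuous _ _).ae_le (ae_restrict_mem measurableSet_Icc)
  filter_upwards [this] with x hx using pow_nonneg hx.1 k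

/-- If the series converged, its partial sums divided by `log n` would tend to 0, not to `c > 0`. -/
lemma tsum_moment_eq_top (hc : 0 < c) (hf : Measurable f)
    (hF : IsProbabilityMeasure (densityLaw f)) (h0 : ∀ x ∈ Set.Icc (0 : ℝ) 1, 0 ≤ f x)
    (hlim : Tendsto f (𝓝[<] 1) (𝓝 c)) : ∑' k, ENNReal.ofReal (moment f k) = ⊤ := by
  by_contra hne
  have hs : Summable (moment f) := by
    have := ENNReal.summable_toReal hne
    simpa only [ENNReal.toReal_ofReal (moment_nonneg _)] using this
  have ht := ((summable_nat_add_iff 1).2 hs).hasSum.tendsto_sum_nat.div_atTop tendsto_log_natCast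
  exact hc.ne (tendsto_nhds_unique ht (tendsto_centering_div_log hf hF h0 hlim))

end BatchLearning

/-! ### Calculus of boundedness in probability -/

namespace BatchLearning

section BoundedInProbability

variable {Ω : Type*} [MeasurableSpace Ω] {P : Measure Ω} {X Y : ℕ → Ω → ℝ}

lemma BoundedInProbability.of_le {g : ℝ → ENNReal} (hg : Tendsto g atTop (𝓝 0))
    (h : ∀ y, 0 < y → ∀ n, 1 ≤ n → P {ω | y < |X n ω|} ≤ g y) : BoundedInProbability P X := by
  refine tendsto_of_tendsto_of_tendsto_of_le_of_le' tendsto_const_nhds hg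
    (Eventually.of_forall fun y => zero_le) ?_
  filter_upwards [eventually_gt_atTop 0] with y hy
  exact iSup₂_le fun n hn => h y hy n hn

lemma BoundedInProbability.const (C : ℝ) : BoundedInProbability P fun _ _ => C := by
  refine tendsto_const_nhds.congr' ?_
  filter_upwards [eventually_ge_atTop |C|] with y hy
  simp [not_lt.2 hy]

lemma BoundedInProbability.add (hX : BoundedInProbability P X) (hY : BoundedInProbability P Y) :
    BoundedInProbability P fun n ω => X n ω + Y n ω := by
  have h2 : Tendsto (fun y : ℝ => y / 2) atTop atTop := tendsto_id.atTop_div_const two_pos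
  have h := (Tendsto.comp hX h2).add (Tendsto.comp hY h2)
  rw [add_zero] at h
  refine .of_le h fun y _ n hn => ?_
  refine le_trans (measure_mono ?_) ((measure_union_le {ω | y / 2 < |X n ω|}
    {ω | y / 2 < |Y n ω|}).trans (add_le_add
      (le_iSup₂ (f := fun (n : ℕ) (_ : 1 ≤ n) => P {ω | y / 2 < |X n ω|}) n hn)
      (le_iSup₂ (f := fun (n : ℕ) (_ : 1 ≤ n) => P {ω | y / 2 < |Y n ω|}) n hn)))
  intro ω hω
  by_contra hc
  simp only [Set.mem_union, Set.mem_ofPred_eq, not_or, not_lt] at hc hω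
  linarith [abs_add_le (X n ω) (Y n ω), hc.1, hc.2]

lemma BoundedInProbability.mono (hX : BoundedInProbability P X)
    (h : ∀ n, 1 ≤ n → ∀ᵐ ω ∂P, |Y n ω| ≤ |X n ω|) : BoundedInProbability P Y := by
  refine .of_le hX fun y _ n hn => ?_
  refine le_trans (measure_mono_ae ?_)
    (le_iSup₂ (f := fun (n : ℕ) (_ : 1 ≤ n) => P {ω | y < |X n ω|}) n hn)
  filter_upwards [h n hn] with ω hω hy
  exact lt_of_lt_of_le hy hω

end BoundedInProbability

/-! ### Tightness of the two parts of the singleton sum -/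

section Overlaps

variable {f : ℝ → ℝ} {Ω : Type*} [MeasurableSpace Ω] {P : Measure Ω} {p : ℕ → Ω → unitInterval}

lemma integral_pow_eq_moment (hm : ∀ i, Measurable (p i))
    (hlaw : ∀ i, P.map (fun ω => (p i ω : ℝ)) = densityLaw f) (i k : ℕ) :
    ∫ ω, (p i ω : ℝ) ^ k ∂P = moment f k := by
  rw [moment, ← hlaw i, integral_map (by have := hm i; fun_prop) (by fun_prop)]

lemma integrable_overlap_pow [IsFiniteMeasure P] (hm : ∀ i, Measurable (p i)) (i k : ℕ) :
    Integrable (fun ω => (p i ω : ℝ) ^ k) P := by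
  refine Integrable.of_bound (C := 1) (by have := hm i; fun_prop) (Eventually.of_forall fun ω => ?_)
  rw [Real.norm_of_nonneg (pow_nonneg (p i ω).2.1 k)]
  exact pow_le_one₀ (p i ω).2.1 (p i ω).2.2

lemma ae_lt_one (hm : ∀ i, Measurable (p i))
    (hlaw : ∀ i, P.map (fun ω => (p i ω : ℝ)) = densityLaw f) :
    ∀ᵐ ω ∂P, ∀ i, (p i ω : ℝ) < 1 := by
  refine ae_all_iff.2 fun i => ?_
  have hac : densityLaw f ≪ volume :=
    (withDensity_absolutelyContinuous _ _).trans Measure.absolutelyContinuous_restrict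
  have h1 : ∀ᵐ x ∂P.map (fun ω => (p i ω : ℝ)), x ≠ 1 := by
    rw [hlaw i]
    exact hac.ae_le (Measure.ae_ne volume 1)
  filter_upwards [ae_of_ae_map (by have := hm i; fun_prop) h1] with ω hω
  exact lt_of_le_of_ne (p i ω).2.2 hω

/-- Unless some overlap exceeds `1 - 1 / (n z)`, every `1 / (1 - pᵢ)` is at most `n z`, and
`restSum` is at most `n z ∑ᵢ pᵢⁿ⁺¹`. The exceptional event costs `K / z` by a union bound; Markov's
inequality gives the other term. -/
lemma measure_restSum_le [IsProbabilityMeasure P] {K D : ℝ} (hK : 0 ≤ K) (hD : 0 ≤ D)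
    (hm : ∀ i, Measurable (p i)) (hlaw : ∀ i, P.map (fun ω => (p i ω : ℝ)) = densityLaw f)
    (htail : ∀ ε : ℝ, 0 < ε → densityLaw f (Set.Ioi (1 - ε)) ≤ ENNReal.ofReal (K * ε))
    (hmom : ∀ k : ℕ, moment f k ≤ D / (k + 1)) {n : ℕ} (hn : 1 ≤ n) {y z : ℝ} (hy : 0 < y)
    (hz : 0 < z) :
    P {ω | y < |restSum (overlaps p n ω) n / n|} ≤ ENNReal.ofReal (K / z + D * z / y) := by
  have hn0 : (0 : ℝ) < n := by exact_mod_cast hn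
  set ε : ℝ := 1 / (n * z) with hε
  have hε0 : 0 < ε := by positivity
  set S : Ω → ℝ := fun ω => ∑ i : Fin n, (p i ω : ℝ) ^ (n + 1) with hS
  have hS0 : ∀ ω, 0 ≤ S ω := fun ω => Finset.sum_nonneg fun i _ => pow_nonneg (p i ω).2.1 _
  have hsub : {ω | y < |restSum (overlaps p n ω) n / n|} ⊆
      (⋃ i : Fin n, {ω | 1 - ε < (p i ω : ℝ)}) ∪ {ω | y / z ≤ S ω} := by
    intro ω hω
    by_contra hc
    simp only [Set.mem_union, Set.mem_iUnion, Set.mem_ofPred_eq, not_or, not_exists, not_lt,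
      not_le] at hc hω
    obtain ⟨h1, h2⟩ := hc
    rw [abs_of_nonneg (div_nonneg (restSum_nonneg _ _) hn0.le)] at hω
    have h3 : restSum (overlaps p n ω) n ≤ n * z * S ω := by
      rw [restSum, hS, Finset.mul_sum]
      refine Finset.sum_le_sum fun i _ => ?_
      have h4 : ε ≤ 1 - (p i ω : ℝ) := by linarith [h1 i]
      have h5 : (n : ℝ) * z = 1 / ε := by rw [hε, one_div_one_div]
      rw [overlaps, h5, one_div_mul_eq_div]
      exact div_le_div_of_nonneg_left (pow_nonneg (p i ω).2.1 _) hε0 h4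
    rw [lt_div_iff₀ hn0] at hω
    rw [lt_div_iff₀ hz] at h2
    nlinarith
  have hA : P (⋃ i : Fin n, {ω | 1 - ε < (p i ω : ℝ)}) ≤ ENNReal.ofReal (K / z) := by
    refine (measure_iUnion_fintype_le _ _).trans ?_
    have h : ∀ i : Fin n, P {ω | 1 - ε < (p i ω : ℝ)} ≤ ENNReal.ofReal (K * ε) := by
      intro i
      refine le_trans (le_of_eq ?_) (htail ε hε0)
      rw [← hlaw i, Measure.map_apply (by have := hm i; fun_prop) measurableSet_Ioi]
      rfl
    refine (Finset.sum_le_sum fun i _ => h i).trans ?_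
    rw [Finset.sum_const, Finset.card_univ, Fintype.card_fin, ← ENNReal.ofReal_nsmul]
    refine ENNReal.ofReal_le_ofReal (le_of_eq ?_)
    rw [nsmul_eq_mul, hε]
    field_simp
  have hB : P {ω | y / z ≤ S ω} ≤ ENNReal.ofReal (D * z / y) := by
    have hint : ∫ ω, S ω ∂P ≤ D := by
      rw [hS, integral_finsetSum _ fun (i : Fin n) _ => integrable_overlap_pow hm i _]
      simp only [integral_pow_eq_moment hm hlaw, Finset.sum_const, Finset.card_univ,
        Fintype.card_fin, nsmul_eq_mul]
      -- The mean of `S` stays bounded because the exponent `n + 1` matches the number `n` of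
      -- overlaps.
      calc (n : ℝ) * moment f (n + 1) ≤ n * (D / ((n + 1 : ℕ) + 1)) := by gcongr; exact hmom _
        _ ≤ D := by
          rw [mul_div_assoc', div_le_iff₀ (by positivity)]
          push_cast
          nlinarith
    have hmarkov := mul_meas_ge_le_integral_of_nonneg (μ := P) (Eventually.of_forall hS0)
      (integrable_finsetSum _ fun (i : Fin n) _ => integrable_overlap_pow (P := P) hm i (n + 1)) (y / z)
    rw [← ofReal_measureReal]
    refine ENNReal.ofReal_le_ofReal ?_
    rw [le_div_iff₀ hy]
    have h6 := hmarkov.trans hint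
    rw [div_mul_eq_mul_div, div_le_iff₀ hz] at h6
    linarith
  refine (measure_mono hsub).trans ((measure_union_le _ _).trans ((add_le_add hA hB).trans ?_))
  rw [ENNReal.ofReal_add (by positivity) (by positivity)]

lemma boundedInProbability_restSum [IsProbabilityMeasure P] {K D : ℝ} (hK : 0 ≤ K) (hD : 0 ≤ D)
    (hm : ∀ i, Measurable (p i)) (hlaw : ∀ i, P.map (fun ω => (p i ω : ℝ)) = densityLaw f)
    (htail : ∀ ε : ℝ, 0 < ε → densityLaw f (Set.Ioi (1 - ε)) ≤ ENNReal.ofReal (K * ε))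
    (hmom : ∀ k : ℕ, moment f k ≤ D / (k + 1)) :
    BoundedInProbability P fun n ω => restSum (overlaps p n ω) n / n := by
  have hlim : Tendsto (fun y : ℝ => ENNReal.ofReal ((K + D) / √y)) atTop (𝓝 0) := by
    rw [← ENNReal.ofReal_zero]
    exact ENNReal.tendsto_ofReal (tendsto_const_nhds.div_atTop Real.tendsto_sqrt_atTop)
  refine .of_le hlim fun y hy n hn => ?_
  -- The choice `z = √y` makes both error terms of order `1 / √y`.
  refine (measure_restSum_le hK hD hm hlaw htail hmom hn hy (Real.sqrt_pos.2 hy)).trans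
    (ENNReal.ofReal_le_ofReal (le_of_eq ?_))
  rw [mul_div_assoc, Real.sqrt_div_self, add_div]
  ring

/-- Adding a term `q = p ^ (m + 1) ≤ 1` to a sum of size at most `m` raises the square by at most
`(2 m + 1) q`, whose mean is at most `2 D`. Linear growth in `n` is what Chebyshev needs: the
trivial bound `n ^ 2` would lose a factor `n`. -/
lemma integral_sq_geom_le [IsProbabilityMeasure P] {D : ℝ} (hD : 0 ≤ D)
    (hm : ∀ i, Measurable (p i)) (hlaw : ∀ i, P.map (fun ω => (p i ω : ℝ)) = densityLaw f)
    (hmom : ∀ k : ℕ, moment f k ≤ D / (k + 1)) (i n : ℕ) :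
    ∫ ω, (∑ k ∈ Finset.range n, (p i ω : ℝ) ^ (k + 1)) ^ 2 ∂P ≤ 2 * D * n := by
  have hg : ∀ (m : ℕ) ω, 0 ≤ ∑ k ∈ Finset.range m, (p i ω : ℝ) ^ (k + 1) ∧
      ∑ k ∈ Finset.range m, (p i ω : ℝ) ^ (k + 1) ≤ m := by
    intro m ω
    refine ⟨Finset.sum_nonneg fun k _ => pow_nonneg (p i ω).2.1 _, ?_⟩
    refine (Finset.sum_le_sum fun k _ => pow_le_one₀ (n := k + 1) (p i ω).2.1 (p i ω).2.2).trans ?_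
    simp
  have hint : ∀ m : ℕ,
      Integrable (fun ω => (∑ k ∈ Finset.range m, (p i ω : ℝ) ^ (k + 1)) ^ 2) P := by
    intro m
    refine Integrable.of_bound (C := (m : ℝ) ^ 2) (by have := hm i; fun_prop)
      (Eventually.of_forall fun ω => ?_)
    rw [Real.norm_of_nonneg (sq_nonneg _)]
    exact pow_le_pow_left₀ (hg m ω).1 (hg m ω).2 2
  induction n with
  | zero => simp
  | succ m ih =>
    have hstep : ∫ ω, (∑ k ∈ Finset.range (m + 1), (p i ω : ℝ) ^ (k + 1)) ^ 2 ∂P ≤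
        ∫ ω, ((∑ k ∈ Finset.range m, (p i ω : ℝ) ^ (k + 1)) ^ 2 +
          (2 * m + 1) * (p i ω : ℝ) ^ (m + 1)) ∂P := by
      refine integral_mono (hint _) ((hint m).add ((integrable_overlap_pow hm i _).const_mul _))
        fun ω => ?_
      simp only [Finset.sum_range_succ]
      have h1 := hg m ω
      have h2 : 0 ≤ (p i ω : ℝ) ^ (m + 1) := pow_nonneg (p i ω).2.1 _
      have h3 : (p i ω : ℝ) ^ (m + 1) ≤ 1 := pow_le_one₀ (p i ω).2.1 (p i ω).2.2
      nlinarith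
    rw [integral_add (hint m) ((integrable_overlap_pow hm i _).const_mul _), integral_const_mul,
      integral_pow_eq_moment hm hlaw] at hstep
    have h4 : (2 * (m : ℝ) + 1) * moment f (m + 1) ≤ 2 * D := by
      refine (mul_le_mul_of_nonneg_left (hmom (m + 1)) (by positivity)).trans ?_
      rw [mul_div_assoc', div_le_iff₀ (by positivity)]
      push_cast
      nlinarith
    push_cast
    linarith

lemma measure_headSum_le [IsProbabilityMeasure P] {D : ℝ} (hD : 0 ≤ D)
    (hm : ∀ i, Measurable (p i)) (hind : iIndepFun p P)
    (hlaw : ∀ i, P.map (fun ω => (p i ω : ℝ)) = densityLaw f)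
    (hmom : ∀ k : ℕ, moment f k ≤ D / (k + 1)) {n : ℕ} (hn : 1 ≤ n) {y : ℝ} (hy : 0 < y) :
    P {ω | y < |headSum (overlaps p n ω) n / n - centering f n|} ≤
      ENNReal.ofReal (2 * D / y ^ 2) := by
  have hn0 : (0 : ℝ) < n := by exact_mod_cast hn
  set φ : unitInterval → ℝ := fun x => ∑ k ∈ Finset.range n, (x : ℝ) ^ (k + 1) with hφ
  have hφm : Measurable φ := by fun_prop
  set G : Fin n → Ω → ℝ := fun i ω => φ (p i ω) with hG
  have hGm : ∀ i, Measurable (G i) := fun i => hφm.comp (hm i)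
  have hG2 : ∀ i, MemLp (G i) 2 P := by
    intro i
    refine MemLp.of_bound (hGm i).aestronglyMeasurable n (Eventually.of_forall fun ω => ?_)
    rw [Real.norm_of_nonneg (Finset.sum_nonneg fun k _ => pow_nonneg (p i ω).2.1 _)]
    refine (Finset.sum_le_sum fun k _ => pow_le_one₀ (n := k + 1) (p i ω).2.1 (p i ω).2.2).trans ?_
    simp
  have hsum : ∀ ω, headSum (overlaps p n ω) n = (∑ i, G i) ω := fun ω => by
    simp [headSum, overlaps, hG, hφ]
  have hmean : P[∑ i, G i] = n * centering f n := by
    have h1 : ∀ i : Fin n, ∫ ω, G i ω ∂P = centering f n := by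
      intro i
      simp only [hG, hφ]
      rw [integral_finsetSum _ fun k _ => integrable_overlap_pow hm i _]
      simp only [integral_pow_eq_moment hm hlaw, centering]
    simp only [Finset.sum_apply]
    rw [integral_finsetSum _ fun i _ => (hG2 i).integrable (by norm_num)]
    simp [h1]
  have hvar : variance (∑ i, G i) P ≤ 2 * D * n ^ 2 := by
    rw [IndepFun.variance_sum (fun i _ => hG2 i)]
    · calc ∑ i : Fin n, variance (G i) P ≤ ∑ i : Fin n, 2 * D * n :=
          Finset.sum_le_sum fun i _ => (variance_le_expectation_sq
            (hGm i).aestronglyMeasurable).trans (integral_sq_geom_le hD hm hlaw hmom i n)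
        _ = 2 * D * n ^ 2 := by simp; ring
    · intro i _ j _ hij
      exact (hind.indepFun (fun h => hij (Fin.ext h))).comp hφm hφm
  have hcheb := meas_ge_le_variance_div_sq (memLp_finsetSum' Finset.univ fun i _ => hG2 i)
    (mul_pos hn0 hy)
  refine le_trans (measure_mono fun ω hω => ?_) (hcheb.trans (ENNReal.ofReal_le_ofReal ?_))
  · simp only [Set.mem_ofPred_eq] at hω ⊢
    rw [hmean, ← hsum]
    have : headSum (overlaps p n ω) n - n * centering f n =
        n * (headSum (overlaps p n ω) n / n - centering f n) := by field_simp
    rw [this, abs_mul, abs_of_pos hn0]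
    exact mul_le_mul_of_nonneg_left hω.le hn0.le
  · refine (div_le_div_of_nonneg_right hvar (by positivity)).trans (le_of_eq ?_)
    field_simp

lemma boundedInProbability_headSum [IsProbabilityMeasure P] {D : ℝ} (hD : 0 ≤ D)
    (hm : ∀ i, Measurable (p i)) (hind : iIndepFun p P)
    (hlaw : ∀ i, P.map (fun ω => (p i ω : ℝ)) = densityLaw f)
    (hmom : ∀ k : ℕ, moment f k ≤ D / (k + 1)) :
    BoundedInProbability P fun n ω => headSum (overlaps p n ω) n / n - centering f n := by
  have hlim : Tendsto (fun y : ℝ => ENNReal.ofReal (2 * D / y ^ 2)) atTop (𝓝 0) := by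
    rw [← ENNReal.ofReal_zero]
    exact ENNReal.tendsto_ofReal (tendsto_const_nhds.div_atTop (tendsto_pow_atTop two_ne_zero))
  exact .of_le hlim fun y hy n hn => measure_headSum_le hD hm hind hlaw hmom hn hy

end Overlaps

end BatchLearning

/-! ### The expectation of the higher part -/

namespace BatchLearning

/-- The difference between the union bound for the tail probability and its true value. -/
noncomputable def unionDefect {n : ℕ} (p : Fin n → unitInterval) (k : ℕ) : ℝ :=
  ∑ i, (p i : ℝ) ^ k - tailProb p k

lemma unionDefect_nonneg {n : ℕ} (p : Fin n → unitInterval) (k : ℕ) : 0 ≤ unionDefect p k :=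
  sub_nonneg.2 (tailProb_le_sum p k)

lemma unionDefect_le {n : ℕ} (p : Fin n → unitInterval) (k : ℕ) : unionDefect p k ≤ n := by
  have h : ∑ i, (p i : ℝ) ^ k ≤ n := by
    refine (Finset.sum_le_sum fun i _ => (pow_mem_unitInterval p i k).2).trans ?_
    simp
  have h0 := tailProb_nonneg p k
  rw [unionDefect]
  linarith

lemma hasSum_unionDefect {n : ℕ} {p : Fin n → unitInterval} (hp : ∀ i, (p i : ℝ) < 1) :
    HasSum (fun k => unionDefect p (k + 1)) (-higherSum p) := by
  simpa [unionDefect] using (hasSum_higherSum hp).neg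

/-- A second-order Bonferroni estimate: the mean union defect `n m - 1 + (1 - m) ^ n` is at most `(n
m) ^ 2`. -/
lemma one_sub_pow_le {m : ℝ} (h0 : 0 ≤ m) (h1 : m ≤ 1) (n : ℕ) :
    (1 - m) ^ n ≤ 1 - n * m + (n * m) ^ 2 := by
  induction n with
  | zero => simp
  | succ n ih =>
    have h := mul_le_mul_of_nonneg_left ih (sub_nonneg.2 h1)
    rw [pow_succ']
    refine h.trans ?_
    push_cast
    have : 0 ≤ (n : ℝ) := n.cast_nonneg
    nlinarith [mul_nonneg (mul_nonneg this this) (pow_nonneg h0 3), mul_nonneg this (sq_nonneg m),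
      sq_nonneg m]

lemma sum_range_inv_sq_le {n : ℕ} (hn : 1 ≤ n) (N : ℕ) :
    ∑ k ∈ Finset.range N, 1 / ((k : ℝ) + n + 2) ^ 2 ≤ 1 / (n : ℝ) := by
  have hn0 : (0 : ℝ) < n := by exact_mod_cast hn
  -- Telescoping: the right side is `1 / ((k + n) (k + n + 1))`.
  have h : ∀ k : ℕ, 1 / ((k : ℝ) + n + 2) ^ 2 ≤ 1 / ((k : ℝ) + n) - 1 / (((k + 1 : ℕ) : ℝ) + n) := by
    intro k
    have hk : (0 : ℝ) < k + n := by positivity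
    push_cast
    rw [div_sub_div _ _ hk.ne' (by positivity), div_le_div_iff₀ (by positivity) (by positivity)]
    nlinarith
  refine (Finset.sum_le_sum fun k _ => h k).trans ?_
  rw [Finset.sum_range_sub' (fun k : ℕ => 1 / ((k : ℝ) + n))]
  have : 0 ≤ 1 / ((N : ℝ) + n) := by positivity
  simp only [Nat.cast_zero, zero_add]
  linarith

variable {f : ℝ → ℝ} {Ω : Type*} [MeasurableSpace Ω] {P : Measure Ω} {p : ℕ → Ω → unitInterval}

lemma measurable_unionDefect (hm : ∀ i, Measurable (p i)) (n k : ℕ) :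
    Measurable fun ω => unionDefect (overlaps p n ω) k := by
  unfold unionDefect tailProb overlaps
  fun_prop

lemma integrable_unionDefect [IsFiniteMeasure P] (hm : ∀ i, Measurable (p i)) (n k : ℕ) :
    Integrable (fun ω => unionDefect (overlaps p n ω) k) P := by
  refine Integrable.of_bound (C := n) (measurable_unionDefect hm n k).aestronglyMeasurable
    (Eventually.of_forall fun ω => ?_)
  rw [Real.norm_of_nonneg (unionDefect_nonneg _ _)]
  exact unionDefect_le _ _

lemma integral_unionDefect [IsProbabilityMeasure P] (hm : ∀ i, Measurable (p i))
    (hind : iIndepFun p P) (hlaw : ∀ i, P.map (fun ω => (p i ω : ℝ)) = densityLaw f) (n k : ℕ) :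
    ∫ ω, unionDefect (overlaps p n ω) k ∂P = n * moment f k - 1 + (1 - moment f k) ^ n := by
  have hind' : iIndepFun (fun i : Fin n => p i) P := hind.precomp Fin.val_injective
  have hprod : ∫ ω, ∏ i : Fin n, (1 - (p i ω : ℝ) ^ k) ∂P = (1 - moment f k) ^ n := by
    rw [hind'.integral_fun_prod_comp (f := fun _ (x : unitInterval) => 1 - (x : ℝ) ^ k)
      (fun i => (hm i).aemeasurable)
      fun _ => (by fun_prop : Measurable fun x : unitInterval =>
        1 - (x : ℝ) ^ k).aestronglyMeasurable]
    have h1 : ∀ i : Fin n, ∫ ω, (1 - (p i ω : ℝ) ^ k) ∂P = 1 - moment f k := fun i => by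
      rw [integral_sub (integrable_const _) (integrable_overlap_pow hm i k),
        integral_pow_eq_moment hm hlaw]
      simp
    simp [h1]
  have hprodint : Integrable (fun ω => ∏ i : Fin n, (1 - (p i ω : ℝ) ^ k)) P := by
    refine Integrable.of_bound (C := 1) (by fun_prop) (Eventually.of_forall fun ω => ?_)
    have h1 := fun i : Fin n => pow_mem_unitInterval (fun i : Fin n => p i ω) i k
    rw [Real.norm_of_nonneg (Finset.prod_nonneg fun i _ => sub_nonneg.2 (h1 i).2)]
    exact Finset.prod_le_one (fun i _ => sub_nonneg.2 (h1 i).2)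
      fun i _ => sub_le_self _ (h1 i).1
  have hsumint : Integrable (fun ω => ∑ i : Fin n, (p i ω : ℝ) ^ k) P :=
    integrable_finsetSum _ fun (i : Fin n) _ => integrable_overlap_pow hm i k
  simp only [unionDefect, tailProb, overlaps]
  have hdiff : Integrable (fun ω => 1 - ∏ i : Fin n, (1 - (p i ω : ℝ) ^ k)) P :=
    (integrable_const 1).sub hprodint
  rw [integral_sub hsumint hdiff, integral_sub (integrable_const 1) hprodint, hprod,
    integral_finsetSum _ fun (i : Fin n) _ => integrable_overlap_pow hm i k]
  simp only [integral_pow_eq_moment hm hlaw]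
  simp
  ring

lemma moment_le_one (hF : IsProbabilityMeasure (densityLaw f)) (k : ℕ) : moment f k ≤ 1 := by
  have h01 : ∀ᵐ x ∂densityLaw f, x ∈ Set.Icc (0 : ℝ) 1 :=
    (withDensity_absolutelyContinuous _ _).ae_le (ae_restrict_mem measurableSet_Icc)
  have h : ∫ x, x ^ k ∂densityLaw f ≤ ∫ _, (1 : ℝ) ∂densityLaw f := by
    refine integral_mono_of_nonneg ?_ (integrable_const _) ?_
    · filter_upwards [h01] with x hx using pow_nonneg hx.1 k
    · filter_upwards [h01] with x hx using pow_le_one₀ hx.1 hx.2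
  simpa [moment] using h

lemma integral_unionDefect_le [IsProbabilityMeasure P] {D : ℝ}
    (hF : IsProbabilityMeasure (densityLaw f)) (hm : ∀ i, Measurable (p i))
    (hind : iIndepFun p P) (hlaw : ∀ i, P.map (fun ω => (p i ω : ℝ)) = densityLaw f)
    (hmom : ∀ k : ℕ, moment f k ≤ D / (k + 1)) (n k : ℕ) :
    ∫ ω, unionDefect (overlaps p n ω) k ∂P ≤ n ^ 2 * D ^ 2 * (1 / ((k : ℝ) + 1) ^ 2) := by
  rw [integral_unionDefect hm hind hlaw]
  have h1 := one_sub_pow_le (moment_nonneg (f := f) k) (moment_le_one hF k) n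
  have h2 : ((n : ℝ) * moment f k) ^ 2 ≤ (n * (D / (k + 1))) ^ 2 := by
    have := moment_nonneg (f := f) k
    gcongr
    exact hmom k
  calc _ ≤ ((n : ℝ) * (D / (k + 1))) ^ 2 := by linarith
    _ = _ := by rw [mul_pow, div_pow]; ring

lemma summable_integral_unionDefect [IsProbabilityMeasure P] {D : ℝ}
    (hF : IsProbabilityMeasure (densityLaw f)) (hm : ∀ i, Measurable (p i))
    (hind : iIndepFun p P) (hlaw : ∀ i, P.map (fun ω => (p i ω : ℝ)) = densityLaw f)
    (hmom : ∀ k : ℕ, moment f k ≤ D / (k + 1)) (n : ℕ) :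
    Summable fun k => ∫ ω, unionDefect (overlaps p n ω) (k + 1) ∂P := by
  refine (summable_nat_add_iff 1 (f := fun k =>
    ∫ ω, unionDefect (overlaps p n ω) k ∂P)).2 ?_
  refine Summable.of_nonneg_of_le (fun k => integral_nonneg fun ω => unionDefect_nonneg _ _)
    (integral_unionDefect_le hF hm hind hlaw hmom n) (Summable.mul_left _ ?_)
  have h := (summable_nat_add_iff 1).2 (Real.summable_one_div_nat_pow.2 one_lt_two)
  simpa using h

lemma measurable_higherSum (hm : ∀ i, Measurable (p i)) (n : ℕ) :
    Measurable fun ω => higherSum (overlaps p n ω) := by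
  unfold higherSum overlaps
  fun_prop

/-- Almost surely `-higherSum` is a series of nonnegative union defects, so by Tonelli it suffices
that their means are summable, and they are `O(1 / k ^ 2)` for fixed `n`. -/
lemma integrable_higherSum [IsProbabilityMeasure P] {D : ℝ}
    (hF : IsProbabilityMeasure (densityLaw f)) (hm : ∀ i, Measurable (p i))
    (hind : iIndepFun p P) (hlaw : ∀ i, P.map (fun ω => (p i ω : ℝ)) = densityLaw f)
    (hmom : ∀ k : ℕ, moment f k ≤ D / (k + 1)) (n : ℕ) :
    Integrable (fun ω => higherSum (overlaps p n ω)) P := by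
  refine ⟨(measurable_higherSum hm n).aestronglyMeasurable, ?_⟩
  rw [← hasFiniteIntegral_neg_iff, hasFiniteIntegral_iff_ofReal]
  · have h : ∀ᵐ ω ∂P, ENNReal.ofReal ((-fun ω => higherSum (overlaps p n ω)) ω) =
        ∑' k, ENNReal.ofReal (unionDefect (overlaps p n ω) (k + 1)) := by
      filter_upwards [ae_lt_one hm hlaw] with ω hω
      have hs := hasSum_unionDefect (p := overlaps p n ω) fun i => hω i
      rw [Pi.neg_apply, ← hs.tsum_eq,
        ENNReal.ofReal_tsum_of_nonneg (fun k => unionDefect_nonneg _ _) hs.summable]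
    rw [lintegral_congr_ae h, lintegral_tsum fun k =>
      (measurable_unionDefect hm n (k + 1)).ennreal_ofReal.aemeasurable]
    simp only [← ofReal_integral_eq_lintegral_ofReal (integrable_unionDefect hm n _)
      (Eventually.of_forall fun ω => unionDefect_nonneg _ _)]
    exact (summable_integral_unionDefect hF hm hind hlaw hmom n).tsum_ofReal_lt_top
  · filter_upwards [ae_lt_one hm hlaw] with ω hω
    exact (hasSum_unionDefect (p := overlaps p n ω) fun i => hω i).nonneg
      fun k => unionDefect_nonneg _ _

lemma hasSum_integral_unionDefect [IsProbabilityMeasure P] {D : ℝ}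
    (hF : IsProbabilityMeasure (densityLaw f)) (hm : ∀ i, Measurable (p i))
    (hind : iIndepFun p P) (hlaw : ∀ i, P.map (fun ω => (p i ω : ℝ)) = densityLaw f)
    (hmom : ∀ k : ℕ, moment f k ≤ D / (k + 1)) (n : ℕ) :
    HasSum (fun k => ∫ ω, unionDefect (overlaps p n ω) (k + 1) ∂P)
      (-∫ ω, higherSum (overlaps p n ω) ∂P) := by
  have h := hasSum_integral_of_summable_integral_norm (μ := P)
    (F := fun k ω => unionDefect (overlaps p n ω) (k + 1))
    (fun k => integrable_unionDefect (P := P) hm n (k + 1)) (by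
      simpa only [Real.norm_of_nonneg (unionDefect_nonneg _ _)] using
        summable_integral_unionDefect hF hm hind hlaw hmom n)
  have heq : ∫ ω, -higherSum (overlaps p n ω) ∂P =
      ∫ ω, ∑' k, unionDefect (overlaps p n ω) (k + 1) ∂P := by
    refine integral_congr_ae ?_
    filter_upwards [ae_lt_one hm hlaw] with ω hω
    exact (hasSum_unionDefect (p := overlaps p n ω) fun i => hω i).tsum_eq.symm
  rw [← integral_neg, heq]
  exact h

/-- For exponents up to `n` the mean defect is `n mₖ` minus a number in `[0, 1]`, so these terms sum
to `n * centering f n` up to an error of at most `n`. Beyond `n` the quadratic bound sums to at most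
`n D ^ 2`. -/
lemma abs_integral_higherSum_le [IsProbabilityMeasure P] {D : ℝ}
    (hF : IsProbabilityMeasure (densityLaw f)) (hm : ∀ i, Measurable (p i))
    (hind : iIndepFun p P) (hlaw : ∀ i, P.map (fun ω => (p i ω : ℝ)) = densityLaw f)
    (hmom : ∀ k : ℕ, moment f k ≤ D / (k + 1)) {n : ℕ} (hn : 1 ≤ n) :
    |(∫ ω, higherSum (overlaps p n ω) ∂P) / n + centering f n| ≤ 1 + D ^ 2 := by
  have hn0 : (0 : ℝ) < n := by exact_mod_cast hn
  have hs := hasSum_integral_unionDefect hF hm hind hlaw hmom n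
  set E : ℕ → ℝ := fun k => ∫ ω, unionDefect (overlaps p n ω) (k + 1) ∂P with hE
  have hE0 : ∀ k, 0 ≤ E k := fun k => integral_nonneg fun ω => unionDefect_nonneg _ _
  have hsplit := hs.summable.sum_add_tsum_nat_add n
  rw [hs.tsum_eq] at hsplit
  have htail0 : 0 ≤ ∑' k, E (k + n) := tsum_nonneg fun k => hE0 _
  have htail : ∑' k, E (k + n) ≤ n * D ^ 2 := by
    refine Real.tsum_le_of_sum_range_le (fun k => hE0 _) fun N => ?_
    calc ∑ k ∈ Finset.range N, E (k + n)
        ≤ ∑ k ∈ Finset.range N, n ^ 2 * D ^ 2 * (1 / ((k : ℝ) + n + 2) ^ 2) := by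
          refine Finset.sum_le_sum fun k _ =>
            (integral_unionDefect_le hF hm hind hlaw hmom n (k + n + 1)).trans (le_of_eq ?_)
          push_cast
          ring
      _ ≤ n ^ 2 * D ^ 2 * (1 / n) := by
          rw [← Finset.mul_sum]
          exact mul_le_mul_of_nonneg_left (sum_range_inv_sq_le hn N) (by positivity)
      _ = n * D ^ 2 := by field_simp
  have hhead : ∑ k ∈ Finset.range n, E k = n * centering f n -
      ∑ k ∈ Finset.range n, (1 - (1 - moment f (k + 1)) ^ n) := by
    rw [centering, Finset.mul_sum, ← Finset.sum_sub_distrib]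
    refine Finset.sum_congr rfl fun k _ => ?_
    rw [hE]
    simp only [integral_unionDefect hm hind hlaw]
    ring
  have hu0 : 0 ≤ ∑ k ∈ Finset.range n, (1 - (1 - moment f (k + 1)) ^ n) :=
    Finset.sum_nonneg fun k _ => sub_nonneg.2 (pow_le_one₀
      (sub_nonneg.2 (moment_le_one hF _)) (sub_le_self _ (moment_nonneg _)))
  have hu1 : ∑ k ∈ Finset.range n, (1 - (1 - moment f (k + 1)) ^ n) ≤ n := by
    refine (Finset.sum_le_sum fun k _ => sub_le_self 1
      (pow_nonneg (sub_nonneg.2 (moment_le_one hF (k + 1))) n)).trans ?_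
    simp
  have heq : (∫ ω, higherSum (overlaps p n ω) ∂P) / n + centering f n =
      (∑ k ∈ Finset.range n, (1 - (1 - moment f (k + 1)) ^ n) - ∑' k, E (k + n)) / n := by
    rw [eq_div_iff hn0.ne', add_mul, div_mul_cancel₀ _ hn0.ne']
    linarith
  rw [heq, abs_le, le_div_iff₀ hn0, div_le_iff₀ hn0]
  -- The numerator lies between `-n D ^ 2` and `n`.
  constructor <;> nlinarith [sq_nonneg D]

lemma lintegral_expectedTime_eq_top [IsProbabilityMeasure P] (hm : ∀ i, Measurable (p i))
    (hlaw : ∀ i, P.map (fun ω => (p i ω : ℝ)) = densityLaw f)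
    (htop : ∑' k, ENNReal.ofReal (moment f k) = ⊤) {n : ℕ} (hn : 1 ≤ n) :
    ∫⁻ ω, expectedTime (overlaps p n ω) ∂P = ⊤ := by
  rw [eq_top_iff, ← htop]
  calc ∑' k, ENNReal.ofReal (moment f k)
      = ∑' k, ∫⁻ ω, ENNReal.ofReal ((p 0 ω : ℝ) ^ k) ∂P := by
        refine tsum_congr fun k => ?_
        rw [← ofReal_integral_eq_lintegral_ofReal (integrable_overlap_pow hm 0 k)
          (Eventually.of_forall fun ω => pow_nonneg (p 0 ω).2.1 k),
          integral_pow_eq_moment hm hlaw]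
    _ = ∫⁻ ω, ∑' k, ENNReal.ofReal ((p 0 ω : ℝ) ^ k) ∂P := by
        rw [lintegral_tsum fun k => by have := hm 0; fun_prop]
    _ ≤ _ := lintegral_mono fun ω => tsum_pow_le_expectedTime (overlaps p n ω) ⟨0, hn⟩

lemma boundedInProbability_expectedTime
    (hm : ∀ i, Measurable (p i)) (hlaw : ∀ i, P.map (fun ω => (p i ω : ℝ)) = densityLaw f)
    (hrest : BoundedInProbability P fun n ω => restSum (overlaps p n ω) n / n) :
    BoundedInProbability P fun n ω => (expectedTime (overlaps p n ω)).toReal / n := by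
  -- The constant 2 bounds `(n + 1) / n`, from the first `n + 1` tail probabilities.
  refine ((BoundedInProbability.const 2).add hrest).mono fun n hn => ?_
  filter_upwards [ae_lt_one hm hlaw] with ω hω
  have hn1 : (1 : ℝ) ≤ n := by exact_mod_cast hn
  have hn0 : (0 : ℝ) < n := by linarith
  have h := toReal_expectedTime_le (p := overlaps p n ω) (fun i => hω i) n
  have h0 := div_nonneg (restSum_nonneg (overlaps p n ω) n) hn0.le
  rw [abs_of_nonneg (div_nonneg ENNReal.toReal_nonneg hn0.le), abs_of_nonneg (by linarith),
    div_le_iff₀ hn0, add_mul, div_mul_cancel₀ _ hn0.ne']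
  linarith

lemma boundedInProbability_singletonSum
    (hm : ∀ i, Measurable (p i)) (hlaw : ∀ i, P.map (fun ω => (p i ω : ℝ)) = densityLaw f)
    (hrest : BoundedInProbability P fun n ω => restSum (overlaps p n ω) n / n)
    (hhead : BoundedInProbability P fun n ω =>
      headSum (overlaps p n ω) n / n - centering f n) :
    BoundedInProbability P fun n ω => singletonSum (overlaps p n ω) / n - centering f n := by
  refine (hhead.add hrest).mono fun n hn => ?_
  filter_upwards [ae_lt_one hm hlaw] with ω hω
  rw [singletonSum_eq (p := overlaps p n ω) (fun i => hω i) n, add_div]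
  exact le_of_eq (congrArg abs (by ring))

/-- The alternating sum is never estimated directly: almost surely it equals `T - T₁ - 1`, and the
tightness of the other terms carries over. -/
lemma boundedInProbability_higherSum
    (hm : ∀ i, Measurable (p i)) (hlaw : ∀ i, P.map (fun ω => (p i ω : ℝ)) = densityLaw f)
    (htime : BoundedInProbability P fun n ω => (expectedTime (overlaps p n ω)).toReal / n)
    (hsing : BoundedInProbability P fun n ω =>
      singletonSum (overlaps p n ω) / n - centering f n) :
    BoundedInProbability P fun n ω => higherSum (overlaps p n ω) / n + centering f n := by
  have hneg : BoundedInProbability P fun n ω =>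
      -(singletonSum (overlaps p n ω) / n - centering f n) :=
    hsing.mono fun n _ => Eventually.of_forall fun ω => (abs_neg _).le
  have hone : BoundedInProbability P fun (n : ℕ) (_ : Ω) => -(1 / (n : ℝ)) := by
    refine (BoundedInProbability.const 1).mono fun n hn => Eventually.of_forall fun ω => ?_
    have hn1 : (1 : ℝ) ≤ n := by exact_mod_cast hn
    rw [abs_neg, abs_one, abs_of_nonneg (by positivity)]
    exact (div_le_one (by linarith)).2 hn1
  refine ((htime.add hneg).add hone).mono fun n hn => ?_
  filter_upwards [ae_lt_one hm hlaw] with ω hω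
  rw [toReal_expectedTime (p := overlaps p n ω) fun i => hω i, tailProb_zero _ hn]
  exact le_of_eq (congrArg abs (by ring))

end BatchLearning

/-! ### Assembly of the theorem -/

theorem mainTheorem3 (f : ℝ → ℝ) (c : ℝ) (hf_meas : Measurable f)
    (hf_nonneg : ∀ x ∈ Set.Icc (0 : ℝ) 1, 0 ≤ f x) (hc : 0 < c)
    (hf_lim : Tendsto f (𝓝[<] 1) (𝓝 c)) :
    ∃ (C : ℝ) (b : ℕ → ℝ),
      Tendsto (fun n : ℕ => b n / Real.log n) atTop (𝓝 c) ∧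
      ∀ (Ω : Type*) [MeasurableSpace Ω] (P : Measure Ω) [IsProbabilityMeasure P]
        (p : ℕ → Ω → unitInterval), (∀ i, Measurable (p i)) → iIndepFun p P →
        (∀ i, P.map (fun ω => (p i ω : ℝ)) =
          (volume.restrict (Set.Icc (0 : ℝ) 1)).withDensity (fun x => ENNReal.ofReal (f x))) →
        -- the expected learning time is almost surely finite, but has no expectation
        (∀ n, ∀ᵐ ω ∂P, BatchLearning.expectedTime (BatchLearning.overlaps p n ω) < ⊤) ∧
        (∀ n, 1 ≤ n →
          ∫⁻ ω, BatchLearning.expectedTime (BatchLearning.overlaps p n ω) ∂P = ⊤) ∧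
        -- the law of large numbers
        Tendsto (fun y : ℝ => ⨆ (n : ℕ) (_ : 1 ≤ n), P {ω | y <
          |(BatchLearning.expectedTime (BatchLearning.overlaps p n ω)).toReal / n - C|})
          atTop (𝓝 0) ∧
        -- the inclusion–exclusion expansion and the cancellation of the `n log n` terms
        (∀ n, 1 ≤ n → ∀ᵐ ω ∂P,
          (BatchLearning.expectedTime (BatchLearning.overlaps p n ω)).toReal =
            1 + BatchLearning.singletonSum (BatchLearning.overlaps p n ω) +
              BatchLearning.higherSum (BatchLearning.overlaps p n ω)) ∧
        BatchLearning.BoundedInProbability P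
          (fun n ω => BatchLearning.singletonSum (BatchLearning.overlaps p n ω) / n - b n) ∧
        BatchLearning.BoundedInProbability P
          (fun n ω => BatchLearning.higherSum (BatchLearning.overlaps p n ω) / n + b n) ∧
        (∀ n, Integrable (fun ω => BatchLearning.higherSum (BatchLearning.overlaps p n ω)) P) ∧
        (∃ M : ℝ, ∀ n : ℕ, 1 ≤ n →
          |(∫ ω, BatchLearning.higherSum (BatchLearning.overlaps p n ω) ∂P) / n + b n| ≤ M) := by

  by_cases hF : IsProbabilityMeasure (BatchLearning.densityLaw f)
  · obtain ⟨D, hD, hmom⟩ := BatchLearning.exists_moment_le hf_meas hF hf_nonneg hf_lim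
    obtain ⟨K, hK, htail⟩ := BatchLearning.exists_tail_le hF hf_lim
    -- Boundedness in probability does not depend on the constant that is subtracted from `T / n`,
    -- so that every `C` would do.
    refine ⟨0, BatchLearning.centering f,
      BatchLearning.tendsto_centering_div_log hf_meas hF hf_nonneg hf_lim, ?_⟩
    intro Ω _ P _ p hm hind hlaw
    have hlaw : ∀ i, P.map (fun ω => (p i ω : ℝ)) = BatchLearning.densityLaw f := hlaw
    have hlt := BatchLearning.ae_lt_one hm hlaw
    have hrest := BatchLearning.boundedInProbability_restSum hK hD hm hlaw htail hmom
    have hhead := BatchLearning.boundedInProbability_headSum hD hm hind hlaw hmom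
    have htime := BatchLearning.boundedInProbability_expectedTime hm hlaw hrest
    have hsing := BatchLearning.boundedInProbability_singletonSum hm hlaw hrest hhead
    refine ⟨fun n => ?_, fun n hn => ?_, ?_, fun n hn => ?_, hsing,
      BatchLearning.boundedInProbability_higherSum hm hlaw htime hsing,
      BatchLearning.integrable_higherSum hF hm hind hlaw hmom, 1 + D ^ 2,
      fun n hn => BatchLearning.abs_integral_higherSum_le hF hm hind hlaw hmom hn⟩
    · filter_upwards [hlt] with ω hω
      exact BatchLearning.expectedTime_lt_top fun i => hω i
    · exact BatchLearning.lintegral_expectedTime_eq_top hm hlaw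
        (BatchLearning.tsum_moment_eq_top hc hf_meas hF hf_nonneg hf_lim) hn
    · simp only [sub_zero]
      exact htime
    · filter_upwards [hlt] with ω hω
      rw [BatchLearning.toReal_expectedTime (p := BatchLearning.overlaps p n ω) fun i => hω i,
        BatchLearning.tailProb_zero _ hn]
  -- If `f` is not a probability density, no overlaps can have this law and the second part is
  -- vacuous. The sequence `c * log n` is chosen only to satisfy the asymptotic condition.
  · refine ⟨0, fun n => c * Real.log n, ?_, ?_⟩
    · refine tendsto_const_nhds.congr' ?_
      filter_upwards [BatchLearning.tendsto_log_natCast.eventually_ne_atTop 0] with n hn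
      rw [mul_div_cancel_right₀ _ hn]
    · intro Ω _ P _ p hm _ hlaw
      refine absurd ?_ hF
      have h : BatchLearning.densityLaw f = P.map fun ω => (p 0 ω : ℝ) := (hlaw 0).symm
      rw [h]
      exact Measure.isProbabilityMeasure_map (by have := hm 0; fun_prop)
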